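/- Let $E$ and $F$ be Banach spaces over $\mathbb{K}=\mathbb{R}$ or $\mathbb{C}$, let $B(E,F)$ be the Banach space of bounded linear operators from $E$ to $F$ with the operator norm, and let $\Lambda=B(E,F)\setminus\{0\}$. For $X\in\Lambda$ let $N(X)$ and $R(X)$ denote the null space and the range of $X$, and let $M(X)=\{T\in B(E,F): T\,N(X)\subset R(X)\}$. Suppose that $A\in\Lambda$ is double splitting, i.e. $R(A)$ is closed and there are closed subspaces $R^+\subset E$ and $N^+\subset F$ with $E=N(A)\oplus R^+$ and $F=R(A)\oplus N^+$ (equivalently, $A$ has a bounded generalized inverse). Then the family $\mathcal{F}=\{M(X)\}_{X\in\Lambda}$ is smooth integrable at $A$; that is, there is a set $S\subset\Lambda$ with $A\in S$ such that: (1) $S$ is a smooth submanifold of $B(E,F)$: for every $X\in S$ there are a splitting $B(E,F)=\mathbf{E}_0\oplus\mathbf{E}_1$ into closed subspaces, an open neighbourhood $U$ of $X$ in $B(E,F)$, and a $C^\infty$ diffeomorphism $\varphi$ (over $\mathbb{K}$) of $U$ onto an open set $\varphi(U)\subset B(E,F)$ such that $\varphi(S\cap U)$ is an open subset of $\mathbf{E}_0$;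 (2) $S$ is tangent to $M(X)$ at every $X\in S$: $M(X)=\{\dot c(0): c \text{ a } C^1\text{ curve in } S \text{ (with real parameter, defined near } 0)\text{ with } c(0)=X\}$. -/

import Mathlib

open scoped ContDiff

namespace BanachFrobenius

section Submanifolds

variable (𝕜 : Type*) [RCLike 𝕜] {V : Type*} [NormedAddCommGroup V] [NormedSpace 𝕜 V]

/-- The set of all velocities `c'(0)` of `C¹` curves `c`, defined on an open interval around `0` in
the real line, with values in `S` and with `c(0) = x`. (If the scalars are complex, curves are still
curves with a real parameter, and `V` is regarded as a real normed space.) -/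
def tangentSet (S : Set V) (x : V) : Set V :=
  letI : NormedSpace ℝ V := NormedSpace.restrictScalars ℝ 𝕜 V
  {v | ∃ (c : ℝ → V) (ε : ℝ), 0 < ε ∧ ContDiffOn ℝ 1 c (Set.Ioo (-ε) ε) ∧
    (∀ t ∈ Set.Ioo (-ε) ε, c t ∈ S) ∧ c 0 = x ∧ HasDerivAt c v 0}

/-- `S` is a smooth submanifold of the Banach space `V`: around every point of `S` there is a smooth
diffeomorphism `φ` from an open set `φ.source` onto an open set `φ.target` of `V`, with smooth
inverse, such that the image of `S ∩ φ.source` is a relatively open subset of a closed subspace `E₀`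
which splits `V`, i.e. has a closed complement `E₁`. -/
def IsSmoothSubmanifold (S : Set V) : Prop :=
  ∀ x ∈ S, ∃ (E₀ E₁ : Submodule 𝕜 V) (φ : OpenPartialHomeomorph V V),
    IsClosed (E₀ : Set V) ∧ IsClosed (E₁ : Set V) ∧ IsCompl E₀ E₁ ∧
    x ∈ φ.source ∧ ContDiffOn 𝕜 ∞ φ φ.source ∧ ContDiffOn 𝕜 ∞ φ.symm φ.target ∧
    ∃ O : Set V, IsOpen O ∧ φ '' (S ∩ φ.source) = O ∩ E₀

/-- The family of subspaces `M(x)`, `x ∈ Λ`, is smooth integrable at `x₀ ∈ Λ`: through `x₀` there is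
a smooth submanifold `S ⊆ Λ` whose tangent space at each of its points `x` is `M(x)`. Only the
values of `M` on `Λ` matter. -/
def SmoothIntegrableAt (Λ : Set V) (M : V → Submodule 𝕜 V) (x₀ : V) : Prop :=
  ∃ S : Set V, x₀ ∈ S ∧ S ⊆ Λ ∧ IsSmoothSubmanifold 𝕜 S ∧
    ∀ x ∈ S, (M x : Set V) = tangentSet 𝕜 S x

end Submanifolds

section Operators

variable {𝕜 : Type*} [RCLike 𝕜]
  {E : Type*} [NormedAddCommGroup E] [NormedSpace 𝕜 E]
  {F : Type*} [NormedAddCommGroup F] [NormedSpace 𝕜 F]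

/-- `A` is double splitting: its range is closed, and its null space and its range have closed
complements. -/
def IsDoubleSplitting (A : E →L[𝕜] F) : Prop :=
  IsClosed (Set.range A) ∧
  (∃ R : Submodule 𝕜 E, IsClosed (R : Set E) ∧ IsCompl (LinearMap.ker (A : E →ₗ[𝕜] F)) R) ∧
  (∃ N : Submodule 𝕜 F, IsClosed (N : Set F) ∧ IsCompl (LinearMap.range (A : E →ₗ[𝕜] F)) N)

/-- Cafagna's family `M(X) = {T : T N(X) ⊆ R(X)}`, as a subspace of the bounded operators. -/
def cafagna (X : E →L[𝕜] F) : Submodule 𝕜 (E →L[𝕜] F) where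
  carrier := {T | ∀ e : E, X e = 0 → T e ∈ LinearMap.range (X : E →ₗ[𝕜] F)}
  add_mem' := fun hS hT e he => Submodule.add_mem _ (hS e he) (hT e he)
  zero_mem' := fun _ _ => Submodule.zero_mem _
  smul_mem' := fun a _ hT e he => Submodule.smul_mem _ a (hT e he)

end Operators

end BanachFrobenius

open scoped ContDiff

namespace BanachFrobenius

/-! ### Submanifolds cut out by a linear equation in a chart. -/

section Charts

variable {𝕜 : Type*} [RCLike 𝕜] {V : Type*} [NormedAddCommGroup V] [NormedSpace 𝕜 V]

/-! Fix a generalized inverse `B` of `A` and write `X` in blocks `a, b; c, d` for the splittings of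
`E` by `BA` and of `F` by `AB`. Near `A` the block `a` is invertible, and `S` is the set where the
Schur complement `d - c a⁻¹ b` vanishes. The chart replacing `d` by this complement is undone by
adding `c a⁻¹ b` back, since that term does not involve `d`; it straightens `S` to a subspace
(`schurChart`). The tangent space of `S` at `X` is thus the kernel of the derivative of the Schur
complement. Put `G = (1 - BA + BX)⁻¹`. On `S`, `G(1 - BA)` maps onto `N(X)` and `XGB` is the
identity on `R(X)`, so the derivative kills `T` exactly when `T` maps `N(X)` into `R(X)`
(`mem_cafagna_iff_of_schur_eq_zero`). -/

/-- The tangent set of a zero set `{y ∈ φ.source | D (φ y) = 0}` cut out in a chart `φ`. -/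
theorem tangentSet_eq_of_chart (φ : OpenPartialHomeomorph V V) (D : V →L[𝕜] V)
    (hφ : ContDiffOn 𝕜 ∞ φ φ.source) (hψ : ContDiffOn 𝕜 ∞ φ.symm φ.target)
    {x : V} (hx : x ∈ φ.source) (hDx : D (φ x) = 0) :
    tangentSet 𝕜 {y | y ∈ φ.source ∧ D (φ y) = 0} x = {v | D (fderiv 𝕜 φ x v) = 0} := by
  let _ : NormedSpace ℝ V := NormedSpace.restrictScalars ℝ 𝕜 V
  have : IsScalarTower ℝ 𝕜 V := ⟨fun a b x => by
    change (a • b) • x = (a : 𝕜) • b • x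
    rw [smul_smul, Algebra.smul_def]⟩
  have hφx : HasFDerivAt φ (fderiv 𝕜 φ x) x :=
    ((hφ.contDiffAt (φ.open_source.mem_nhds hx)).differentiableAt (by simp)).hasFDerivAt
  ext v
  constructor
  · rintro ⟨c, ε, hε, -, hcS, rfl, hc⟩
    have h1 : HasDerivAt (fun t => D (φ (c t))) (D (fderiv 𝕜 φ (c 0) v)) 0 :=
      ((D.hasFDerivAt.comp _ hφx).restrictScalars ℝ).comp_hasDerivAt (0 : ℝ) hc
    have h2 : HasDerivAt (fun t => D (φ (c t))) 0 0 := by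
      refine (hasDerivAt_const (0 : ℝ) (0 : V)).congr_of_eventuallyEq ?_
      filter_upwards [Ioo_mem_nhds (neg_lt_zero.2 hε) hε] with t ht
      exact (hcS t ht).2
    exact h1.unique h2
  · intro hv
    set w := fderiv 𝕜 φ x v
    have hy : φ x ∈ φ.target := φ.map_source hx
    have hψy : HasFDerivAt φ.symm (fderiv 𝕜 φ.symm (φ x)) (φ x) :=
      ((hψ.contDiffAt (φ.open_target.mem_nhds hy)).differentiableAt (by simp)).hasFDerivAt
    have hinv : fderiv 𝕜 φ.symm (φ x) w = v := by
      have h1 := hψy.comp x hφx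
      have h2 : HasFDerivAt (φ.symm ∘ φ) (ContinuousLinearMap.id 𝕜 V) x := by
        refine (hasFDerivAt_id x).congr_of_eventuallyEq ?_
        filter_upwards [φ.open_source.mem_nhds hx] with z hz using φ.left_inv hz
      exact congrArg (fun L : V →L[𝕜] V => L v) (h1.unique h2)
    have hline : ContDiff ℝ 1 (fun t : ℝ => φ x + t • w) := by fun_prop
    have hopen : IsOpen ((fun t : ℝ => φ x + t • w) ⁻¹' φ.target) :=
      φ.open_target.preimage hline.continuous
    obtain ⟨ε, hε, hball⟩ := Metric.isOpen_iff.1 hopen 0 (by simpa using hy)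
    have hI : ∀ t ∈ Set.Ioo (-ε) ε, φ x + t • w ∈ φ.target := fun t ht =>
      hball (by rw [Real.ball_eq_Ioo]; simpa using ht)
    -- The curve is a straight line in the kernel of `D`, pulled back through the chart.
    refine ⟨fun t => φ.symm (φ x + t • w), ε, hε, ?_, ?_, ?_, ?_⟩
    · exact ((hψ.restrict_scalars ℝ).of_le (by simp)).comp hline.contDiffOn hI
    · intro t ht
      refine ⟨φ.map_target (hI t ht), ?_⟩
      rw [φ.right_inv (hI t ht), map_add, hDx, zero_add,
        ← algebraMap_smul 𝕜 t w, map_smul, hv, smul_zero]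
    · simp [φ.left_inv hx]
    · have hl : HasDerivAt (fun t : ℝ => φ x + t • w) w 0 := by
        simpa using ((hasDerivAt_id (0 : ℝ)).smul_const w).const_add (φ x)
      have h0 : φ x = φ x + (0 : ℝ) • w := by simp
      rw [← hinv]
      exact (hψy.restrictScalars ℝ).comp_hasDerivAt_of_eq (0 : ℝ) hl h0

/-- A zero set cut out by an idempotent in a chart is a smooth submanifold. -/
theorem isSmoothSubmanifold_of_chart (φ : OpenPartialHomeomorph V V) (D : V →L[𝕜] V)
    (hD : ∀ z, D (D z) = D z)
    (hφ : ContDiffOn 𝕜 ∞ φ φ.source) (hψ : ContDiffOn 𝕜 ∞ φ.symm φ.target) :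
    IsSmoothSubmanifold 𝕜 {y | y ∈ φ.source ∧ D (φ y) = 0} := by
  rintro x ⟨hx, -⟩
  have hproj : IsIdempotentElem (D : V →ₗ[𝕜] V) := LinearMap.ext hD
  refine ⟨LinearMap.ker (D : V →ₗ[𝕜] V), LinearMap.range (D : V →ₗ[𝕜] V), φ, D.isClosed_ker,
    ?_, (LinearMap.IsIdempotentElem.isCompl hproj).symm, hx, hφ, hψ, φ.target, φ.open_target, ?_⟩
  · have : ((LinearMap.range (D : V →ₗ[𝕜] V) : Submodule 𝕜 V) : Set V) = {z | D z = z} := by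
      ext z
      exact ⟨by rintro ⟨y, rfl⟩; exact hD y, fun h => ⟨z, h⟩⟩
    rw [this]
    exact isClosed_eq D.continuous continuous_id
  · ext y
    constructor
    · rintro ⟨z, ⟨⟨hz, hDz⟩, -⟩, rfl⟩
      exact ⟨φ.map_source hz, hDz⟩
    · rintro ⟨hy, hDy⟩
      refine ⟨φ.symm y, ⟨⟨φ.map_target hy, ?_⟩, φ.map_target hy⟩, φ.right_inv hy⟩
      rw [φ.right_inv hy]
      exact hDy

end Charts

/-! ### Generalized inverses and the block algebra of the Schur complement. -/

section Operators

variable {𝕜 : Type*} [RCLike 𝕜]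
  {E : Type*} [NormedAddCommGroup E] [NormedSpace 𝕜 E]
  {F : Type*} [NormedAddCommGroup F] [NormedSpace 𝕜 F]

/-- A double splitting operator between Banach spaces has a bounded generalized inverse. -/
theorem IsDoubleSplitting.exists_generalizedInverse [CompleteSpace E] [CompleteSpace F]
    {A : E →L[𝕜] F} (hA : IsDoubleSplitting A) :
    ∃ B : F →L[𝕜] E, (∀ x, A (B (A x)) = A x) ∧ ∀ y, B (A (B y)) = B y := by
  obtain ⟨-, ⟨R, hRc, hR⟩, N, hNc, hN⟩ := hA
  have := hRc.completeSpace_coe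
  have := hNc.completeSpace_coe
  let J : (R × N) →L[𝕜] F := (A ∘L R.subtypeL).coprod N.subtypeL
  have hJ : ∀ r n, J (r, n) = A r + n := fun r n => by simp [J]
  have hinj : Function.Injective J := by
    rw [injective_iff_map_eq_zero]
    rintro ⟨r, n⟩ h
    rw [hJ] at h
    have hn : (n : F) = 0 := by
      refine Submodule.disjoint_def.1 hN.disjoint _ ⟨-r, ?_⟩ n.2
      simpa [neg_eq_iff_add_eq_zero] using h
    have hr : (r : E) = 0 := by
      refine Submodule.disjoint_def.1 hR.disjoint _ ?_ r.2
      simpa [hn] using h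
    exact Prod.ext (Subtype.ext hr) (Subtype.ext hn)
  have hdecomp : ∀ x, ∃ r : R, A r = A x := fun x => by
    obtain ⟨k, hk, r, hr, rfl⟩ := Submodule.mem_sup.1
      (hR.sup_eq_top ▸ Submodule.mem_top : x ∈ LinearMap.ker (A : E →ₗ[𝕜] F) ⊔ R)
    refine ⟨⟨r, hr⟩, ?_⟩
    have : A k = 0 := hk
    simp [this]
  have hsurj : Function.Surjective J := fun y => by
    obtain ⟨_, ⟨x, rfl⟩, n, hn, rfl⟩ := Submodule.mem_sup.1
      (hN.sup_eq_top ▸ Submodule.mem_top : y ∈ LinearMap.range (A : E →ₗ[𝕜] F) ⊔ N)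
    obtain ⟨r, hr⟩ := hdecomp x
    exact ⟨(r, ⟨n, hn⟩), by rw [hJ, hr]; rfl⟩
  -- The open mapping theorem bounds the inverse of `J`; `B` is its `R`-component.
  let e := ContinuousLinearEquiv.ofBijective J (LinearMap.ker_eq_bot.2 hinj)
    (LinearMap.range_eq_top.2 hsurj)
  let B : F →L[𝕜] E := R.subtypeL ∘L ContinuousLinearMap.fst 𝕜 R N ∘L (e.symm : F →L[𝕜] R × N)
  have hBA : ∀ r : R, B (A r) = r := fun r => by
    have h : e (r, 0) = A r := by
      change J (r, 0) = A r
      simp [hJ]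
    change (((e.symm (A r)).1 : R) : E) = r
    rw [← h, e.symm_apply_apply]
  refine ⟨B, fun x => ?_, fun y => hBA (e.symm y).1⟩
  obtain ⟨r, hr⟩ := hdecomp x
  rw [← hr, hBA]

/-- The operator `1 - BA + BX` on `E`, which is invertible for `X` near `A`. -/
def pencil (A : E →L[𝕜] F) (B : F →L[𝕜] E) (X : E →L[𝕜] F) : E →L[𝕜] E :=
  1 - B ∘L A + B ∘L X

/-- Minus the product `c a⁻¹ b` of the blocks of `X`, placed in the lower right corner. -/
noncomputable def correction (A : E →L[𝕜] F) (B : F →L[𝕜] E) (X : E →L[𝕜] F) : E →L[𝕜] F :=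
  (1 - A ∘L B) ∘L X ∘L (B ∘L A) ∘L Ring.inverse (pencil A B X) ∘L (1 - B ∘L A)

/-- The Schur complement of `X` relative to the blocks given by `A` and `B`. -/
noncomputable def schur (A : E →L[𝕜] F) (B : F →L[𝕜] E) (X : E →L[𝕜] F) : E →L[𝕜] F :=
  X ∘L Ring.inverse (pencil A B X) ∘L (1 - B ∘L A)

/-- The lower right corner of an operator. -/
noncomputable def corner (A : E →L[𝕜] F) (B : F →L[𝕜] E) : (E →L[𝕜] F) →L[𝕜] (E →L[𝕜] F) :=
  (ContinuousLinearMap.compL 𝕜 E F F (1 - A ∘L B)) ∘L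
    ((ContinuousLinearMap.compL 𝕜 E E F).flip (1 - B ∘L A))

variable {A : E →L[𝕜] F} {B : F →L[𝕜] E}

theorem corner_apply (Z : E →L[𝕜] F) (x : E) :
    corner A B Z x = Z (x - B (A x)) - A (B (Z (x - B (A x)))) := by
  simp [corner]
  abel

theorem pencil_apply (X : E →L[𝕜] F) (x : E) : pencil A B X x = x - B (A x) + B (X x) := by
  simp [pencil]

theorem correction_apply (X : E →L[𝕜] F) (x : E) :
    correction A B X x = X (B (A (Ring.inverse (pencil A B X) (x - B (A x))))) -
      A (B (X (B (A (Ring.inverse (pencil A B X) (x - B (A x))))))) := by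
  simp [correction]
  abel

theorem schur_apply (X : E →L[𝕜] F) (x : E) :
    schur A B X x = X (Ring.inverse (pencil A B X) (x - B (A x))) := by
  simp [schur]

theorem pencil_inverse_apply {X : E →L[𝕜] F} (hX : IsUnit (pencil A B X)) (x : E) :
    pencil A B X (Ring.inverse (pencil A B X) x) = x :=
  congrArg (fun L : E →L[𝕜] E => L x) (Ring.mul_inverse_cancel _ hX)

theorem inverse_pencil_apply {X : E →L[𝕜] F} (hX : IsUnit (pencil A B X)) (x : E) :
    Ring.inverse (pencil A B X) (pencil A B X x) = x :=
  congrArg (fun L : E →L[𝕜] E => L x) (Ring.inverse_mul_cancel _ hX)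

theorem corner_idem (hA : ∀ x, A (B (A x)) = A x) (Z : E →L[𝕜] F) :
    corner A B (corner A B Z) = corner A B Z := by
  ext x
  simp [corner_apply, hA]

theorem corner_correction (hA : ∀ x, A (B (A x)) = A x) (X : E →L[𝕜] F) :
    corner A B (correction A B X) = correction A B X := by
  ext x
  simp [corner_apply, correction_apply, hA]

/-- Since `B(1 - AB) = 0`, the pencil does not see the block `d`. -/
theorem pencil_add_corner (hB : ∀ y, B (A (B y)) = B y) (X Z : E →L[𝕜] F) :
    pencil A B (X + corner A B Z) = pencil A B X := by
  ext x
  simp [pencil_apply, corner_apply, hB]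

/-- Besides the pencil, the correction reads `X` only on the range of `BA`, where corner operators
vanish. Hence adding and subtracting it are mutually inverse. -/
theorem correction_add_corner (hB : ∀ y, B (A (B y)) = B y)
    (X Z : E →L[𝕜] F) : correction A B (X + corner A B Z) = correction A B X := by
  ext x
  simp [correction_apply, pencil_add_corner hB, corner_apply, hB]

theorem pencil_add_correction (hA : ∀ x, A (B (A x)) = A x) (hB : ∀ y, B (A (B y)) = B y)
    (X : E →L[𝕜] F) : pencil A B (X + correction A B X) = pencil A B X := by
  rw [← corner_correction hA, pencil_add_corner hB]

theorem pencil_sub_correction (hA : ∀ x, A (B (A x)) = A x) (hB : ∀ y, B (A (B y)) = B y)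
    (X : E →L[𝕜] F) : pencil A B (X - correction A B X) = pencil A B X := by
  rw [← corner_correction hA, sub_eq_add_neg, ← map_neg, pencil_add_corner hB]

theorem correction_add_correction (hA : ∀ x, A (B (A x)) = A x) (hB : ∀ y, B (A (B y)) = B y)
    (X : E →L[𝕜] F) : correction A B (X + correction A B X) = correction A B X := by
  conv_lhs => rw [← corner_correction hA X, correction_add_corner hB]

theorem correction_sub_correction (hA : ∀ x, A (B (A x)) = A x) (hB : ∀ y, B (A (B y)) = B y)
    (X : E →L[𝕜] F) : correction A B (X - correction A B X) = correction A B X := by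
  conv_lhs =>
    rw [← corner_correction hA X, sub_eq_add_neg, ← map_neg, correction_add_corner hB]

theorem corner_add_correction (hA : ∀ x, A (B (A x)) = A x) (hB : ∀ y, B (A (B y)) = B y)
    {X : E →L[𝕜] F} (hX : IsUnit (pencil A B X)) :
    corner A B (X + correction A B X) = schur A B X := by
  rw [map_add, corner_correction hA]
  ext x
  rw [add_apply, corner_apply, correction_apply, schur_apply]
  set n := x - B (A x) with hn
  have hAn : A n = 0 := by simp [hn, hA]
  set u := Ring.inverse (pencil A B X) n with hu
  have h1 : u - B (A u) + B (X u) = n := by rw [← pencil_apply, pencil_inverse_apply hX]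
  have h3 : B (X u) = 0 := by
    -- Applying `BA` isolates the `R(B)`-component of `h1`; it vanishes on the right because `n`
    -- lies in `N(A)`.
    have := congrArg (fun z => B (A z)) h1
    simpa only [map_add, map_sub, hA, hB, hAn, sub_self, zero_add, map_zero] using this
  have h2 : B (A u) = u - n := by rw [← h1, h3]; abel
  rw [h2]
  simp only [map_sub, h3]
  simp

theorem pencil_self (A : E →L[𝕜] F) (B : F →L[𝕜] E) : pencil A B A = 1 := by simp [pencil]

theorem schur_self (hA : ∀ x, A (B (A x)) = A x) : schur A B A = 0 := by
  ext x
  simp [schur_apply, pencil_self, hA]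

/-- Cafagna's subspace at a zero of the Schur complement is the kernel of its derivative. -/
theorem mem_cafagna_iff_of_schur_eq_zero {X : E →L[𝕜] F}
    (hX : IsUnit (pencil A B X)) (hS : schur A B X = 0) (T : E →L[𝕜] F) :
    T ∈ cafagna X ↔ T ∘L Ring.inverse (pencil A B X) ∘L (1 - B ∘L A) -
        X ∘L Ring.inverse (pencil A B X) ∘L B ∘L T ∘L Ring.inverse (pencil A B X) ∘L (1 - B ∘L A) = 0 := by
  have hS' : ∀ x, X (Ring.inverse (pencil A B X) (x - B (A x))) = 0 := fun x => by
    rw [← schur_apply, hS]; rfl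
  constructor
  · intro hT
    ext x
    obtain ⟨h, hh⟩ := hT _ (hS' x)
    replace hh : X h = T (Ring.inverse (pencil A B X) (x - B (A x))) := hh
    have h1 : B (X h) = pencil A B X h - (h - B (A h)) := by rw [pencil_apply]; abel
    -- `XGB` fixes `R(X)`: `G(BXh)` differs from `h` by `G(1 - BA)h`, which `X` kills.
    have h2 : X (Ring.inverse (pencil A B X) (B (X h))) = X h := by
      rw [h1, map_sub, map_sub, hS', inverse_pencil_apply hX, sub_zero]
    simp only [sub_apply, ContinuousLinearMap.comp_apply,
      one_apply_eq_self, zero_apply]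
    rw [← hh, h2, sub_self]
  · intro hT e he
    -- Every null vector of `X` is its own image under `G(1 - BA)`.
    have h1 : Ring.inverse (pencil A B X) (e - B (A e)) = e := by
      have : pencil A B X e = e - B (A e) := by simp [pencil_apply, he]
      rw [← this, inverse_pencil_apply hX]
    have h2 := congrArg (fun L : E →L[𝕜] F => L e) hT
    simp only [sub_apply, ContinuousLinearMap.comp_apply,
      one_apply_eq_self, zero_apply, h1] at h2
    exact ⟨_, (sub_eq_zero.1 h2).symm⟩

/-! ### Smoothness, the derivative and the chart. -/

variable [CompleteSpace E]

theorem isOpen_isUnit_pencil (A : E →L[𝕜] F) (B : F →L[𝕜] E) :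
    IsOpen {X | IsUnit (pencil A B X)} := by
  have : Continuous (pencil A B) := by unfold pencil; fun_prop
  exact Units.isOpen.preimage this

theorem contDiffOn_inverse_pencil (A : E →L[𝕜] F) (B : F →L[𝕜] E) :
    ContDiffOn 𝕜 ∞ (fun X => Ring.inverse (pencil A B X)) {X | IsUnit (pencil A B X)} := by
  rintro X ⟨u, hu⟩
  have h : ContDiff 𝕜 ∞ (pencil A B) := by unfold pencil; fun_prop
  refine ContDiffAt.contDiffWithinAt ?_
  exact ContDiffAt.comp X (hu ▸ contDiffAt_ringInverse 𝕜 u) h.contDiffAt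

theorem contDiffOn_correction (A : E →L[𝕜] F) (B : F →L[𝕜] E) :
    ContDiffOn 𝕜 ∞ (correction A B) {X | IsUnit (pencil A B X)} := by
  have := contDiffOn_inverse_pencil A B
  unfold correction
  fun_prop

theorem hasFDerivAt_schur {X : E →L[𝕜] F} (hX : IsUnit (pencil A B X)) :
    ∃ L : (E →L[𝕜] F) →L[𝕜] (E →L[𝕜] F), HasFDerivAt (schur A B) L X ∧
      ∀ T, L T = T ∘L Ring.inverse (pencil A B X) ∘L (1 - B ∘L A) -
        X ∘L Ring.inverse (pencil A B X) ∘L B ∘L T ∘L Ring.inverse (pencil A B X) ∘L (1 - B ∘L A) := by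
  obtain ⟨u, hu⟩ := id hX
  have h1 : HasFDerivAt (pencil A B) (ContinuousLinearMap.compL 𝕜 E F E B) X :=
    (ContinuousLinearMap.compL 𝕜 E F E B).hasFDerivAt.const_add (1 - B ∘L A)
  have h2 := (hu ▸ hasFDerivAt_ringInverse (𝕜 := 𝕜) u :
    HasFDerivAt Ring.inverse _ (pencil A B X)).comp X h1
  have h3 := (hasFDerivAt_id X).clm_comp (h2.clm_comp (hasFDerivAt_const (1 - B ∘L A) X))
  refine ⟨_, h3, fun T => ?_⟩
  have hinv : Ring.inverse (pencil A B X) = (↑u⁻¹ : E →L[𝕜] E) := by rw [← hu, Ring.inverse_unit]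
  ext x
  simp [hinv]
  abel

/-- The chart straightening the operators with vanishing Schur complement. -/
noncomputable def schurChart (hA : ∀ x, A (B (A x)) = A x) (hB : ∀ y, B (A (B y)) = B y) :
    OpenPartialHomeomorph (E →L[𝕜] F) (E →L[𝕜] F) where
  toFun X := X + correction A B X
  invFun Y := Y - correction A B Y
  source := {X | IsUnit (pencil A B X)}
  target := {X | IsUnit (pencil A B X)}
  map_source' X hX := by simpa [pencil_add_correction hA hB] using hX
  map_target' X hX := by simpa [pencil_sub_correction hA hB] using hX
  left_inv' X _ := by simp [correction_add_correction hA hB]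
  right_inv' X _ := by simp [correction_sub_correction hA hB]
  open_source := isOpen_isUnit_pencil A B
  open_target := isOpen_isUnit_pencil A B
  continuousOn_toFun := continuousOn_id.add (contDiffOn_correction A B).continuousOn
  continuousOn_invFun := continuousOn_id.sub (contDiffOn_correction A B).continuousOn

end Operators

end BanachFrobenius

open BanachFrobenius in
theorem theorem4p1 {𝕜 : Type*} [RCLike 𝕜]
    {E : Type*} [NormedAddCommGroup E] [NormedSpace 𝕜 E] [CompleteSpace E]
    {F : Type*} [NormedAddCommGroup F] [NormedSpace 𝕜 F] [CompleteSpace F]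
    (A : E →L[𝕜] F) (hA₀ : A ∈ ({0}ᶜ : Set (E →L[𝕜] F)))
    (hA : BanachFrobenius.IsDoubleSplitting A) :
    BanachFrobenius.SmoothIntegrableAt 𝕜 ({0}ᶜ : Set (E →L[𝕜] F))
      (fun X => BanachFrobenius.cafagna X) A := by
  obtain ⟨B, hAB, hBA⟩ := hA.exists_generalizedInverse
  have hφ : ContDiffOn 𝕜 ∞ (schurChart hAB hBA) (schurChart hAB hBA).source :=
    contDiffOn_id.add (contDiffOn_correction A B)
  have hψ : ContDiffOn 𝕜 ∞ (schurChart hAB hBA).symm (schurChart hAB hBA).target :=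
    contDiffOn_id.sub (contDiffOn_correction A B)
  have hcorner : ∀ X ∈ (schurChart hAB hBA).source,
      corner A B (schurChart hAB hBA X) = schur A B X :=
    fun X hX => corner_add_correction hAB hBA hX
  have hAmem : A ∈ (schurChart hAB hBA).source := by
    change IsUnit (pencil A B A)
    rw [pencil_self]
    exact isUnit_one
  refine ⟨{X | X ∈ (schurChart hAB hBA).source ∧ corner A B (schurChart hAB hBA X) = 0},
    ⟨hAmem, by rw [hcorner A hAmem, schur_self hAB]⟩, ?_,
    isSmoothSubmanifold_of_chart _ _ (corner_idem hAB) hφ hψ, ?_⟩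
  · rintro X ⟨hX, -⟩ rfl
    refine hA₀ ?_
    have hX' : IsUnit (pencil A B 0) := hX
    ext x
    -- At `X = 0` the pencil is the projection `1 - BA`; if invertible, it forces `BA = 0` and so `A
    -- = ABA = 0`.
    have h : pencil A B 0 (B (A x)) = 0 := by simp [pencil_apply, hBA]
    have h' : B (A x) = 0 := by rw [← inverse_pencil_apply hX' (B (A x)), h, map_zero]
    rw [← hAB x, h']
    simp
  · rintro X ⟨hX, hDX⟩
    rw [tangentSet_eq_of_chart _ _ hφ hψ hX hDX]
    obtain ⟨L, hL, hLT⟩ := hasFDerivAt_schur (A := A) (B := B) hX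
    have hSX : schur A B X = 0 := by rw [← hcorner X hX, hDX]
    have hnhds := (schurChart hAB hBA).open_source.mem_nhds hX
    have h1 := (corner A B).hasFDerivAt.comp X
      ((hφ.contDiffAt hnhds).differentiableAt (by simp)).hasFDerivAt
    -- The corner of the chart equals the Schur complement on a neighbourhood of `X`, so the
    -- derivatives agree.
    have h2 := h1.unique (hL.congr_of_eventuallyEq (Filter.mem_of_superset hnhds hcorner))
    ext T
    have h3 : corner A B (fderiv 𝕜 (schurChart hAB hBA) X T) = L T :=
      congrArg (fun K : (E →L[𝕜] F) →L[𝕜] (E →L[𝕜] F) => K T) h2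
    change T ∈ cafagna X ↔ corner A B (fderiv 𝕜 (schurChart hAB hBA) X T) = 0
    rw [h3, hLT]
    exact mem_cafagna_iff_of_schur_eq_zero hX hSX T
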